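/- Let $A=\mathbb{C}^{d_A}$ and $B=\mathbb{C}^{d_B}$ be finite-dimensional Hilbert spaces, let $\mathcal{U}:\mathrm{L}(A)\to\mathrm{L}(B)$ be a linear map (for instance, with $A=B$, the unitary channel $\mathcal{U}(\rho)=U\rho U^\dagger$), let $\{\mathcal{E}_i\}_i$ be a fixed finite family of linear maps $\mathrm{L}(A)\to\mathrm{L}(B)$ (the decomposition set), and let $\gamma_{\mathrm{budget}}\in\mathbb{R}$. For a linear map $\mathcal{G}:\mathrm{L}(A)\to\mathrm{L}(B)$, let $\|\mathcal{G}\|_\diamond=\sup\{\|(\mathcal{G}\otimes\mathrm{id}_{\mathrm{L}(A)})(X)\|_1: X\in \mathrm{L}(A\otimes A),\ \|X\|_1\le 1\}$ be its diamond norm, where $\|\cdot\|_1$ is the trace norm, and let $\Lambda_{\mathcal{G}}=\sum_{p,q}\mathcal{G}(|p\rangle\langle q|)\otimes|p\rangle\langle q|\in\mathrm{L}(B\otimes A)$ be its unnormalised Choi matrix. Write $\|\cdot\|_\infty$ for the spectral norm, $\mathrm{tr}_B$ for the partial trace $\mathrm{L}(B\otimes A)\to\mathrm{L}(A)$, and $^*$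 for the adjoint. Consider the budget-constrained approximate quasiprobability decomposition problem $$\text{(P)}\qquad \min_{a_i\in\mathbb{R}}\ \Big\|\mathcal{U}-\sum_i a_i\mathcal{E}_i\Big\|_\diamond\quad\text{s.t.}\quad \sum_i|a_i|\le\gamma_{\mathrm{budget}}$$ and the program $$\text{(S)}\qquad \min_{a_i\in\mathbb{R},\;Y_0,Y_1\in\mathrm{L}(B\otimes A)}\ \tfrac12\|\mathrm{tr}_B[Y_0]\|_\infty+\tfrac12\|\mathrm{tr}_B[Y_1]\|_\infty$$ $$\text{s.t.}\quad \begin{pmatrix}Y_0&\sum_i a_i\Lambda_{\mathcal{E}_i}-\Lambda_{\mathcal{U}}\\ \sum_i a_i\Lambda_{\mathcal{E}_i}^*-\Lambda_{\mathcal{U}}^*&Y_1\end{pmatrix}\ge0,\quad \sum_i|a_i|\le\gamma_{\mathrm{budget}},\quad Y_0\ge0,\ Y_1\ge0 .$$ Then: 1. (S) is a semidefinite program, in the sense that its epigraph, i.e. the set of all $(a,Y_0,Y_1,t)$ with $(a,Y_0,Y_1)$ feasible and objective value at most $t$, is described by a linear matrix inequality with finitely many real auxiliary variables. 2. If $\gamma_{\mathrm{budget}}\ge0$,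 then the minima in (P) and in (S) are both attained, and they are equal. 3. For every fixed $a$ with $\sum_i|a_i|\le\gamma_{\mathrm{budget}}$, the minimum of the objective of (S) over all $(Y_0,Y_1)$ for which $(a,Y_0,Y_1)$ is feasible is attained and equals $\|\mathcal{U}-\sum_i a_i\mathcal{E}_i\|_\diamond$. 4. A coefficient vector $a$ is a minimiser of (P) if and only if there are $Y_0,Y_1$ such that $(a,Y_0,Y_1)$ is a minimiser of (S). -/

import Mathlib

/-! Systems `A`, `B` are finite-dimensional Hilbert spaces `ℂ^a`, `ℂ^b` for finite index types
`a`, `b`; `L(A)` is `Matrix a a ℂ`, and `L(B ⊗ A)` is `Matrix (b × a) (b × a) ℂ`. -/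

namespace ApproxQPD

noncomputable section

open scoped ComplexOrder

variable {a b r ι : Type*} [Fintype a] [DecidableEq a] [Fintype b] [DecidableEq b]
  [Fintype r] [DecidableEq r] [Fintype ι]

/-- Trace norm `‖X‖₁ = tr √(X* X)`: the sum of the singular values of `X`. -/
def traceNorm (X : Matrix r r ℂ) : ℝ :=
  ∑ i, √((Matrix.isHermitian_conjTranspose_mul_self X).eigenvalues i)

/-- Spectral norm `‖X‖_∞`: the operator norm of `X` on Euclidean space. -/
def specNorm (X : Matrix r r ℂ) : ℝ :=
  ‖Matrix.toEuclideanCLM (n := r) (𝕜 := ℂ) X‖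

/-- `(Φ ⊗ id_{L(R)})(X)`: apply `Φ` to each `A`-block of `X ∈ L(A ⊗ R)`. -/
def tensorId (Φ : Matrix a a ℂ →ₗ[ℂ] Matrix b b ℂ) (X : Matrix (a × r) (a × r) ℂ) :
    Matrix (b × r) (b × r) ℂ :=
  Matrix.of fun i j => Φ (Matrix.of fun p q => X (p, i.2) (q, j.2)) i.1 j.1

/-- Diamond norm `‖Φ‖_⋄ = sup { ‖(Φ ⊗ id_{L(A)})(X)‖₁ : X ∈ L(A ⊗ A), ‖X‖₁ ≤ 1 }`.
The set contains `0`, and it is bounded because the spaces are finite-dimensional. -/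
def diamondNorm (Φ : Matrix a a ℂ →ₗ[ℂ] Matrix b b ℂ) : ℝ :=
  sSup {t : ℝ | ∃ X : Matrix (a × a) (a × a) ℂ,
    traceNorm X ≤ 1 ∧ t = traceNorm (tensorId Φ X)}

/-- The (unnormalised) Choi matrix `Λ_Φ = ∑_{p,q} Φ(E_{pq}) ⊗ E_{pq} ∈ L(B ⊗ A)`. -/
def choi (Φ : Matrix a a ℂ →ₗ[ℂ] Matrix b b ℂ) : Matrix (b × a) (b × a) ℂ :=
  Matrix.of fun i j => Φ (Matrix.single i.2 j.2 1) i.1 j.1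

/-- Partial trace `tr_B : L(B ⊗ A) → L(A)`. -/
def partialTraceB (Y : Matrix (b × a) (b × a) ℂ) : Matrix a a ℂ :=
  Matrix.of fun p q => ∑ i, Y (i, p) (i, q)

/-- The `γ`-factor `∑ |a_i|` of real coefficients. -/
def gammaFactor (c : ι → ℝ) : ℝ := ∑ i, |c i|

/-- Feasible set of the budget-constrained approximate QPD problem. -/
def budgetFeasible (ι : Type*) [Fintype ι] (γ : ℝ) : Set (ι → ℝ) := {c | gammaFactor c ≤ γ}

/-- Objective of the budget-constrained approximate QPD problem: `‖𝒰 - ∑ a_i ℰ_i‖_⋄`. -/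
def budgetObjective (U : Matrix a a ℂ →ₗ[ℂ] Matrix b b ℂ)
    (E : ι → Matrix a a ℂ →ₗ[ℂ] Matrix b b ℂ) (c : ι → ℝ) : ℝ :=
  diamondNorm (U - ∑ i, (c i : ℂ) • E i)

/-- The variables `(a_i, Y₀, Y₁)` of the semidefinite program. -/
abbrev SDPVar (a b ι : Type*) : Type _ :=
  (ι → ℝ) × Matrix (b × a) (b × a) ℂ × Matrix (b × a) (b × a) ℂ

/-- Feasible set of the semidefinite program. -/
def sdpFeasible (U : Matrix a a ℂ →ₗ[ℂ] Matrix b b ℂ)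
    (E : ι → Matrix a a ℂ →ₗ[ℂ] Matrix b b ℂ) (γ : ℝ) : Set (SDPVar a b ι) :=
  {z | (Matrix.fromBlocks
          z.2.1 (∑ i, (z.1 i : ℂ) • choi (E i) - choi U)
          (∑ i, (z.1 i : ℂ) • (choi (E i)).conjTranspose - (choi U).conjTranspose)
          z.2.2).PosSemidef ∧
       gammaFactor z.1 ≤ γ ∧ z.2.1.PosSemidef ∧ z.2.2.PosSemidef}

/-- Objective of the semidefinite program: `½ ‖tr_B Y₀‖_∞ + ½ ‖tr_B Y₁‖_∞`. -/
def sdpObjective (z : SDPVar a b ι) : ℝ :=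
  1 / 2 * specNorm (partialTraceB z.2.1) + 1 / 2 * specNorm (partialTraceB z.2.2)

/-- A set in a real vector space is semidefinite representable if it is described, with finitely
many real auxiliary variables, by one linear matrix inequality `C + L (x, u) ≥ 0`. (Requiring
`C + L (x, u)` to be positive semidefinite includes requiring it to be Hermitian, which is a
system of real linear equations in `(x, u)`.) -/
def SemidefiniteRepresentable {V : Type*} [AddCommGroup V] [Module ℝ V] (S : Set V) : Prop :=
  ∃ (N m : ℕ) (C : Matrix (Fin m) (Fin m) ℂ)
    (L : V × (Fin N → ℝ) →ₗ[ℝ] Matrix (Fin m) (Fin m) ℂ),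
    ∀ x : V, x ∈ S ↔ ∃ u : Fin N → ℝ, (C + L (x, u)).PosSemidef

/-- Minimising `f` over `S` is a semidefinite program: its epigraph is semidefinite
representable, so that it amounts to minimising the linear function `t` subject to a linear
matrix inequality. -/
def IsSemidefiniteProgram {V : Type*} [AddCommGroup V] [Module ℝ V] (S : Set V) (f : V → ℝ) :
    Prop :=
  SemidefiniteRepresentable {y : V × ℝ | y.1 ∈ S ∧ f y.1 ≤ y.2}

end

end ApproxQPD

namespace ApproxQPD

noncomputable section

open scoped ComplexOrder
open Matrix Kronecker

/-! ### The trace norm -/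

/-! Everything reduces to one fact: for a fixed linear map `Φ`, minimising over block matrices with
corner `choi Φ` gives the diamond norm. Weak duality (`traceNorm_tensorId_le`) holds because `Φ ⊗
id` sends a rank-one input to a congruence of `choi Φ` (`tensorId_vecMulVec`), so a feasible `(Y₀,
Y₁)` yields a positive block matrix around the output, and the trace norm of a corner is at most the
mean of the diagonal traces. For the converse, the spectral norm of a positive matrix is the largest
pairing with a density matrix, so the dual program is a min-max over `Y` and pairs `(σ₀, σ₁)`.
Sion's theorem swaps the two. For fixed invertible `σ₀, σ₁`, the vectorised factors `M₀, M₁` give an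
input of trace norm at most `1`; an optimal block matrix around its output, pulled back by `1 ⊗
Mᵢ⁻¹`, is a feasible `Y`. Singular `σᵢ` follow by perturbation. Sublevel sets of (S) are compact, so
its minima are attained. Since minimising (S) over `Y` alone returns the objective of (P), values
and minimisers of the two problems agree. Representability comes from lifting absolute values and
norms to linear inequalities. -/

theorem diagonal_inv_mul_cancel_of_gram {r : Type*} [Fintype r] [DecidableEq r]
    {G : Matrix r r ℂ} {s : r → ℝ}
    (hG : Gᴴ * G = diagonal (fun i => ((s i ^ 2 : ℝ) : ℂ))) :
    G * diagonal (fun i => ((s i)⁻¹ : ℂ)) * diagonal (fun i => (s i : ℂ)) = G := by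
  ext k i
  rw [Matrix.mul_assoc, diagonal_mul_diagonal, mul_diagonal]
  by_cases hi : s i = 0
  · have h := congrFun (congrFun hG i) i
    rw [mul_apply, diagonal_apply_eq, hi] at h
    have h2 : ∑ j, (‖G j i‖ ^ 2 : ℝ) = 0 := by
      have : ((∑ j, (‖G j i‖ ^ 2 : ℝ) : ℝ) : ℂ) = 0 := by
        rw [← Complex.ofReal_zero]
        push_cast
        rw [← (show _ = (0 : ℂ) by simpa using h)]
        refine Finset.sum_congr rfl fun j _ => ?_
        exact (Complex.conj_mul' _).symm
      exact_mod_cast this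
    have h3 := (Finset.sum_eq_zero_iff_of_nonneg (fun j _ => by positivity)).1 h2 k
      (Finset.mem_univ _)
    have h4 : G k i = 0 := by simpa using h3
    simp [h4]
  · have : (s i : ℂ) ≠ 0 := by exact_mod_cast hi
    field_simp

/-- A singular value decomposition with a partial isometry `W` and a unitary `V`. -/
theorem exists_singularValueDecomposition {r : Type*} [Fintype r] [DecidableEq r]
    (T : Matrix r r ℂ) :
    ∃ (W V : Matrix r r ℂ) (s : r → ℝ), (∀ i, 0 ≤ s i) ∧ ∑ i, s i = traceNorm T ∧
      Vᴴ * V = 1 ∧ V * Vᴴ = 1 ∧ T = W * diagonal (fun i => (s i : ℂ)) * Vᴴ ∧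
      W * Wᴴ * W = W ∧
      diagonal (fun i => (s i : ℂ)) * (Wᴴ * W) = diagonal (fun i => (s i : ℂ)) := by
  set hH := isHermitian_conjTranspose_mul_self T
  set V : Matrix r r ℂ := (hH.eigenvectorUnitary : Matrix r r ℂ) with hV
  set s : r → ℝ := fun i => √(hH.eigenvalues i) with hs
  have hV1 : Vᴴ * V = 1 := Unitary.coe_star_mul_self _
  have hV2 : V * Vᴴ = 1 := Unitary.coe_mul_star_self _
  set G := T * V with hGdef
  have hG : Gᴴ * G = diagonal (fun i => ((s i ^ 2 : ℝ) : ℂ)) := by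
    have h := hH.conjStarAlgAut_star_eigenvectorUnitary
    rw [Unitary.conjStarAlgAut_apply] at h
    simp only [star_star, Unitary.coe_star] at h
    have h2 : (diagonal (RCLike.ofReal ∘ hH.eigenvalues) : Matrix r r ℂ) =
        diagonal (fun i => ((s i ^ 2 : ℝ) : ℂ)) := by
      congr 1
      ext i
      simp only [hs, Function.comp]
      rw [Real.sq_sqrt (eigenvalues_conjTranspose_mul_self_nonneg T i)]
      rfl
    rw [← h2, ← h, hGdef, conjTranspose_mul]
    simp only [Matrix.mul_assoc]
    rfl
  set D : Matrix r r ℂ := diagonal (fun i => (s i : ℂ)) with hD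
  -- Since `0⁻¹ = 0`, `D'` is the pseudoinverse of `D`, and `G * D'` is only a partial isometry,
  -- vanishing on the kernel directions.
  set D' : Matrix r r ℂ := diagonal (fun i => ((s i)⁻¹ : ℂ)) with hD'
  have hcancel : G * D' * D = G := diagonal_inv_mul_cancel_of_gram hG
  have hD'H : D'ᴴ = D' := by
    rw [hD', diagonal_conjTranspose]
    congr 1
    ext i
    simp
  have hWW : (G * D')ᴴ * (G * D') = D' * (diagonal (fun i => ((s i ^ 2 : ℝ) : ℂ))) * D' := by
    rw [conjTranspose_mul, hD'H, ← hG]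
    simp only [Matrix.mul_assoc]
  refine ⟨G * D', V, s, fun i => Real.sqrt_nonneg _, rfl, hV1, hV2, ?_, ?_, ?_⟩
  · rw [hcancel, hGdef, Matrix.mul_assoc, hV2, Matrix.mul_one]
  · rw [Matrix.mul_assoc, hWW, Matrix.mul_assoc, hD', diagonal_mul_diagonal,
      diagonal_mul_diagonal, diagonal_mul_diagonal]
    congr 2
    ext i
    by_cases hi : (s i : ℂ) = 0
    · simp [hi]
    · push_cast; field_simp
  · rw [hWW, hD', diagonal_mul_diagonal, diagonal_mul_diagonal, diagonal_mul_diagonal]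
    congr 1
    ext i
    by_cases hi : (s i : ℂ) = 0
    · simp [hi]
    · push_cast; field_simp

theorem posSemidef_diagonal_ofReal {r : Type*} [Fintype r] [DecidableEq r] {s : r → ℝ}
    (hs : ∀ i, 0 ≤ s i) : (diagonal (fun i => (s i : ℂ))).PosSemidef :=
  PosSemidef.diagonal fun i => by simpa using hs i

/-- Every matrix is the corner of a positive semidefinite block matrix whose diagonal blocks
have trace equal to the trace norm. -/
theorem exists_posSemidef_fromBlocks_trace_eq {r : Type*} [Fintype r] [DecidableEq r]
    (T : Matrix r r ℂ) :
    ∃ P Q : Matrix r r ℂ, (fromBlocks P T Tᴴ Q).PosSemidef ∧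
      P.trace = (traceNorm T : ℂ) ∧ Q.trace = (traceNorm T : ℂ) := by
  obtain ⟨W, V, s, hs, hsum, hV1, hV2, hT, hW, hsW⟩ := exists_singularValueDecomposition T
  set D : Matrix r r ℂ := diagonal (fun i => (s i : ℂ)) with hD
  have hDps : D.PosSemidef := posSemidef_diagonal_ofReal hs
  have htr : D.trace = (traceNorm T : ℂ) := by
    rw [← hsum, hD, trace_diagonal]; push_cast; rfl
  refine ⟨W * D * Wᴴ, V * D * Vᴴ, ?_, ?_, ?_⟩
  · have h := hDps.mul_mul_conjTranspose_same (fromRows W V)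
    convert h using 1
    rw [conjTranspose_fromRows_eq_fromCols_conjTranspose, fromRows_mul, fromRows_mul_fromCols,
      hT]
    congr 1
    rw [conjTranspose_mul, conjTranspose_mul, conjTranspose_conjTranspose, hDps.isHermitian.eq,
      Matrix.mul_assoc]
  · rw [trace_mul_comm, ← Matrix.mul_assoc, trace_mul_comm, hsW, htr]
  · rw [trace_mul_comm, ← Matrix.mul_assoc, hV1, Matrix.one_mul, htr]

/-- `W * Wᴴ` is an orthogonal projection, and the compression of `P` to its complement has
nonnegative trace. -/
theorem re_trace_conjTranspose_mul_mul_le {r : Type*} [Fintype r] [DecidableEq r]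
    {P W : Matrix r r ℂ} (hP : P.PosSemidef) (hW : W * Wᴴ * W = W) :
    (Wᴴ * P * W).trace.re ≤ P.trace.re := by
  set Q : Matrix r r ℂ := 1 - W * Wᴴ with hQ
  have hQH : Qᴴ = Q := by simp [hQ]
  have hQQ : Q * Q = Q := by
    rw [hQ, Matrix.mul_sub, Matrix.mul_one, Matrix.sub_mul, Matrix.one_mul,
      ← Matrix.mul_assoc (W * Wᴴ), hW, sub_self, sub_zero]
  have h := (hP.conjTranspose_mul_mul_same Q).trace_nonneg
  rw [hQH, trace_mul_comm, ← Matrix.mul_assoc, hQQ, hQ, Matrix.sub_mul, Matrix.one_mul,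
    trace_sub, Matrix.mul_assoc, trace_mul_comm W, Matrix.mul_assoc] at h
  have h2 := (Complex.le_def.1 h).1
  simp only [Complex.zero_re, Complex.sub_re] at h2
  rw [Matrix.mul_assoc]
  linarith

/-- The trace norm of a corner of a positive semidefinite block matrix is at most the mean of
the traces of the diagonal blocks. -/
theorem traceNorm_le_of_posSemidef_fromBlocks {r : Type*} [Fintype r] [DecidableEq r]
    {P T Q : Matrix r r ℂ} (h : (fromBlocks P T Tᴴ Q).PosSemidef) :
    traceNorm T ≤ 1 / 2 * P.trace.re + 1 / 2 * Q.trace.re := by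
  obtain ⟨W, V, s, hs, hsum, hV1, hV2, hT, hW, hsW⟩ := exists_singularValueDecomposition T
  set D : Matrix r r ℂ := diagonal (fun i => (s i : ℂ)) with hD
  have htr : D.trace = (traceNorm T : ℂ) := by
    rw [← hsum, hD, trace_diagonal]; push_cast; rfl
  have hP : P.PosSemidef := by
    exact h.submatrix Sum.inl
  have h1 : (Wᴴ * T * V).trace = (traceNorm T : ℂ) := by
    rw [← htr, hT, Matrix.mul_assoc, Matrix.mul_assoc (W * D), hV1, Matrix.mul_one,
      ← Matrix.mul_assoc, trace_mul_comm, hsW]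
  have h2 : (Vᴴ * Tᴴ * W).trace = (traceNorm T : ℂ) := by
    have : Vᴴ * Tᴴ * W = (Wᴴ * T * V)ᴴ := by
      simp [conjTranspose_mul, Matrix.mul_assoc]
    rw [this, trace_conjTranspose, h1]
    simp
  have h3 : (Vᴴ * Q * V).trace = Q.trace := by
    rw [trace_mul_comm, ← Matrix.mul_assoc, hV2, Matrix.one_mul]
  have h4 := re_trace_conjTranspose_mul_mul_le hP hW
  -- Compressing the block matrix by the column `(W, -V)` makes each off-diagonal term contribute
  -- `-traceNorm T`.
  have h5 := (h.conjTranspose_mul_mul_same (fromRows W (-V))).trace_nonneg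
  rw [conjTranspose_fromRows_eq_fromCols_conjTranspose, fromCols_mul_fromBlocks,
    fromCols_mul_fromRows] at h5
  simp only [conjTranspose_neg, Matrix.neg_mul, Matrix.mul_neg, Matrix.add_mul, trace_add,
    trace_neg, h1, h2, h3] at h5
  have h6 := (Complex.le_def.1 h5).1
  simp at h6
  linarith

/-! ### Weak duality for the diamond norm -/

section WeakDuality

variable {a b r : Type*} [Fintype a] [DecidableEq a] [Fintype b] [DecidableEq b]
  [Fintype r] [DecidableEq r]

omit [Fintype a] [DecidableEq a] [Fintype b] [DecidableEq b] [Fintype r] [DecidableEq r] in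
theorem tensorId_sum {κ : Type*} (s : Finset κ) (Φ : Matrix a a ℂ →ₗ[ℂ] Matrix b b ℂ)
    (X : κ → Matrix (a × r) (a × r) ℂ) :
    tensorId Φ (∑ k ∈ s, X k) = ∑ k ∈ s, tensorId Φ (X k) := by
  ext i j
  have h : (of fun p q => (∑ k ∈ s, X k) (p, i.2) (q, j.2)) =
      ∑ k ∈ s, of fun p q => X k (p, i.2) (q, j.2) := by
    ext p q
    simp [Matrix.sum_apply]
  rw [tensorId, of_apply, h, map_sum, Matrix.sum_apply, Matrix.sum_apply]
  rfl

/-- The vector `u ∈ A ⊗ R` read as an operator `A → R`. -/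
def vecToMat (u : a × r → ℂ) : Matrix r a ℂ := of fun k p => u (p, k)

-- Both directions of duality rest on this: vectors of `A ⊗ R` become operators acting on the input
-- leg of the Choi matrix.
omit [Fintype r] [DecidableEq r] in
theorem tensorId_vecMulVec (Φ : Matrix a a ℂ →ₗ[ℂ] Matrix b b ℂ) (u v : a × r → ℂ) :
    tensorId Φ (vecMulVec u (star v)) =
      ((1 : Matrix b b ℂ) ⊗ₖ vecToMat u) * choi Φ * ((1 : Matrix b b ℂ) ⊗ₖ vecToMat v)ᴴ := by
  ext i j
  have h : (of fun p q => vecMulVec u (star v) (p, i.2) (q, j.2)) =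
      ∑ p, ∑ q, (u (p, i.2) * star (v (q, j.2))) • single p q (1 : ℂ) := by
    conv_lhs => rw [matrix_eq_sum_single (of fun p q => vecMulVec u (star v) (p, i.2) (q, j.2))]
    refine Finset.sum_congr rfl fun p _ => Finset.sum_congr rfl fun q _ => ?_
    rw [smul_single]
    simp [vecMulVec_apply]
  rw [tensorId, of_apply, h]
  simp only [map_sum, map_smul, Matrix.sum_apply, Matrix.smul_apply, smul_eq_mul]
  rw [mul_apply]
  simp only [mul_apply, conjTranspose_apply, kroneckerMap_apply, Fintype.sum_prod_type, vecToMat,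
    of_apply, choi, one_apply, ite_mul, one_mul, zero_mul, Finset.sum_ite_irrel,
    Finset.sum_const_zero, Finset.sum_ite_eq, Finset.mem_univ, if_true, star_zero, mul_ite,
    apply_ite star, mul_zero]
  rw [Finset.sum_comm]
  simp only [Finset.sum_mul]
  refine Finset.sum_congr rfl fun q _ => Finset.sum_congr rfl fun p _ => ?_
  ring

omit [DecidableEq a] [DecidableEq r] in
theorem trace_kronecker_mul_mul_conjTranspose (M : Matrix r a ℂ) (Y : Matrix (b × a) (b × a) ℂ) :
    (((1 : Matrix b b ℂ) ⊗ₖ M) * Y * ((1 : Matrix b b ℂ) ⊗ₖ M)ᴴ).trace =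
      (M * partialTraceB Y * Mᴴ).trace := by
  simp only [trace, diag_apply, mul_apply, conjTranspose_apply, kroneckerMap_apply,
    Fintype.sum_prod_type, one_apply, ite_mul, one_mul, zero_mul, Finset.sum_ite_irrel,
    Finset.sum_const_zero, Finset.sum_ite_eq, Finset.mem_univ, if_true, star_zero,
    mul_ite, apply_ite star, mul_zero, partialTraceB, of_apply, Finset.mul_sum, Finset.sum_mul]
  rw [Finset.sum_comm]
  refine Finset.sum_congr rfl fun k _ => ?_
  rw [Finset.sum_comm]
  refine Finset.sum_congr rfl fun q _ => ?_
  rw [Finset.sum_comm]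

omit [Fintype a] [DecidableEq a] [DecidableEq b] in
theorem posSemidef_partialTraceB {Y : Matrix (b × a) (b × a) ℂ} (hY : Y.PosSemidef) :
    (partialTraceB Y).PosSemidef := by
  have h : partialTraceB Y = ∑ i : b, Y.submatrix (fun p => (i, p)) (fun p => (i, p)) := by
    ext p q
    simp [partialTraceB, Matrix.sum_apply]
  rw [h]
  exact posSemidef_sum _ fun i _ => hY.submatrix _

omit [DecidableEq a] [DecidableEq b] in
theorem trace_partialTraceB (Y : Matrix (b × a) (b × a) ℂ) :
    (partialTraceB Y).trace = Y.trace := by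
  simp only [trace, diag_apply, partialTraceB, of_apply, Fintype.sum_prod_type]
  exact Finset.sum_comm

-- This is the C⋆-algebraic order characterisation of the norm; it makes the objective expressible
-- by linear matrix inequalities.
open scoped Matrix.Norms.L2Operator MatrixOrder in
theorem specNorm_le_iff {N : Matrix r r ℂ} (hN : N.PosSemidef) {s : ℝ} (hs : 0 ≤ s) :
    specNorm N ≤ s ↔ ((s : ℂ) • (1 : Matrix r r ℂ) - N).PosSemidef := by
  have h := CStarAlgebra.norm_le_iff_le_algebraMap N hs hN.nonneg
  rw [specNorm, l2_opNorm_toEuclideanCLM, h, le_iff, Algebra.algebraMap_eq_smul_one]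
  rfl

theorem specNorm_nonneg (N : Matrix r r ℂ) : 0 ≤ specNorm N := norm_nonneg _

omit [DecidableEq r] in
theorem re_trace_mul_mul_conjTranspose_le {N : Matrix a a ℂ} (hN : N.PosSemidef)
    (M : Matrix r a ℂ) :
    (M * N * Mᴴ).trace.re ≤ specNorm N * (M * Mᴴ).trace.re := by
  have h := ((specNorm_le_iff hN (specNorm_nonneg N)).1 le_rfl).mul_mul_conjTranspose_same M
  have h2 := (Complex.le_def.1 h.trace_nonneg).1
  rw [Matrix.mul_sub, Matrix.sub_mul, trace_sub, Matrix.mul_smul, Matrix.mul_one,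
    Matrix.smul_mul, trace_smul] at h2
  simp at h2
  exact h2

omit [DecidableEq a] [DecidableEq r] in
theorem trace_vecToMat_mul_conjTranspose (u : a × r → ℂ) :
    (vecToMat u * (vecToMat u)ᴴ).trace = (vecMulVec u (star u)).trace := by
  simp only [trace, diag_apply, mul_apply, conjTranspose_apply, vecToMat, of_apply,
    vecMulVec_apply, Fintype.sum_prod_type, Pi.star_apply]
  exact Finset.sum_comm

theorem posSemidef_fromBlocks_mul {m n : Type*} [Fintype m] [Fintype n]
    {P T Q : Matrix n n ℂ} (h : (fromBlocks P T Tᴴ Q).PosSemidef) (K L : Matrix m n ℂ) :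
    (fromBlocks (K * P * Kᴴ) (K * T * Lᴴ) (K * T * Lᴴ)ᴴ (L * Q * Lᴴ)).PosSemidef := by
  have h2 := h.mul_mul_conjTranspose_same (fromBlocks K 0 0 L)
  rw [fromBlocks_conjTranspose, fromBlocks_multiply, fromBlocks_multiply] at h2
  simpa [conjTranspose_mul, Matrix.mul_assoc] using h2

theorem posSemidef_fromBlocks_sum {n κ : Type*} [Fintype n] (s : Finset κ)
    {P T Q : κ → Matrix n n ℂ} (h : ∀ k ∈ s, (fromBlocks (P k) (T k) (T k)ᴴ (Q k)).PosSemidef) :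
    (fromBlocks (∑ k ∈ s, P k) (∑ k ∈ s, T k) (∑ k ∈ s, T k)ᴴ (∑ k ∈ s, Q k)).PosSemidef := by
  have h2 := posSemidef_sum s h
  convert h2 using 1
  ext (i | i) (j | j) <;> simp [Matrix.sum_apply]

theorem posSemidef_fromBlocks_neg {n : Type*} [Fintype n] [DecidableEq n] {P T Q : Matrix n n ℂ}
    (h : (fromBlocks P T Tᴴ Q).PosSemidef) : (fromBlocks P (-T) (-T)ᴴ Q).PosSemidef := by
  have h2 := posSemidef_fromBlocks_mul h (1 : Matrix n n ℂ) (-1)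
  simpa using h2

/-- Weak duality: any feasible `(Y₀, Y₁)` bounds the trace norm of the outputs of `Φ ⊗ id`. -/
theorem traceNorm_tensorId_le {Φ : Matrix a a ℂ →ₗ[ℂ] Matrix b b ℂ}
    {Y₀ Y₁ : Matrix (b × a) (b × a) ℂ} (h₀ : Y₀.PosSemidef) (h₁ : Y₁.PosSemidef)
    (h : (fromBlocks Y₀ (choi Φ) (choi Φ)ᴴ Y₁).PosSemidef)
    {X : Matrix (a × r) (a × r) ℂ} (hX : traceNorm X ≤ 1) :
    traceNorm (tensorId Φ X) ≤
      1 / 2 * specNorm (partialTraceB Y₀) + 1 / 2 * specNorm (partialTraceB Y₁) := by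
  obtain ⟨P, Q, hPQ, hP, hQ⟩ := exists_posSemidef_fromBlocks_trace_eq X
  -- Splitting the positive block matrix around `X` into rank-one terms, and each vector into halves
  -- `u k`, `v k`, decomposes `P`, `X` and `Q` simultaneously.
  obtain ⟨m, A, hA⟩ := posSemidef_iff_eq_sum_vecMulVec.1 hPQ
  set u : Fin m → a × r → ℂ := fun k i => A k (Sum.inl i) with hu
  set v : Fin m → a × r → ℂ := fun k i => A k (Sum.inr i) with hv
  have hPu : P = ∑ k, vecMulVec (u k) (star (u k)) := by
    ext i j
    have := congrFun (congrFun hA (Sum.inl i)) (Sum.inl j)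
    simpa [Matrix.sum_apply, vecMulVec_apply] using this
  have hQv : Q = ∑ k, vecMulVec (v k) (star (v k)) := by
    ext i j
    have := congrFun (congrFun hA (Sum.inr i)) (Sum.inr j)
    simpa [Matrix.sum_apply, vecMulVec_apply] using this
  have hXuv : X = ∑ k, vecMulVec (u k) (star (v k)) := by
    ext i j
    have := congrFun (congrFun hA (Sum.inl i)) (Sum.inr j)
    simpa [Matrix.sum_apply, vecMulVec_apply] using this
  have hb := posSemidef_fromBlocks_sum Finset.univ fun k _ =>
    posSemidef_fromBlocks_mul h ((1 : Matrix b b ℂ) ⊗ₖ vecToMat (u k))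
      ((1 : Matrix b b ℂ) ⊗ₖ vecToMat (v k))
  have hT : tensorId Φ X = ∑ k, ((1 : Matrix b b ℂ) ⊗ₖ vecToMat (u k)) * choi Φ *
      ((1 : Matrix b b ℂ) ⊗ₖ vecToMat (v k))ᴴ := by
    rw [hXuv, tensorId_sum]
    exact Finset.sum_congr rfl fun k _ => tensorId_vecMulVec Φ _ _
  rw [← hT] at hb
  refine (traceNorm_le_of_posSemidef_fromBlocks hb).trans ?_
  -- Tracing out `B` leaves pairings with `partialTraceB Y`; the weights sum to `traceNorm X ≤ 1`.
  have key : ∀ {Y : Matrix (b × a) (b × a) ℂ} (_ : Y.PosSemidef) {R : Matrix (a × r) (a × r) ℂ}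
      {w : Fin m → a × r → ℂ} (_ : R = ∑ k, vecMulVec (w k) (star (w k)))
      (_ : R.trace = (traceNorm X : ℂ)),
      (∑ k, ((1 : Matrix b b ℂ) ⊗ₖ vecToMat (w k)) * Y *
        ((1 : Matrix b b ℂ) ⊗ₖ vecToMat (w k))ᴴ).trace.re ≤ specNorm (partialTraceB Y) := by
    intro Y hY R w hR hRX
    rw [trace_sum, Complex.re_sum]
    calc _ ≤ ∑ k, specNorm (partialTraceB Y) * (vecToMat (w k) * (vecToMat (w k))ᴴ).trace.re := by
          refine Finset.sum_le_sum fun k _ => ?_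
          rw [trace_kronecker_mul_mul_conjTranspose]
          exact re_trace_mul_mul_conjTranspose_le (posSemidef_partialTraceB hY) _
      _ = specNorm (partialTraceB Y) * traceNorm X := by
          simp_rw [trace_vecToMat_mul_conjTranspose]
          rw [← Finset.mul_sum, ← Complex.re_sum, ← trace_sum, ← hR, hRX, Complex.ofReal_re]
      _ ≤ specNorm (partialTraceB Y) := mul_le_of_le_one_right (specNorm_nonneg _) hX
  have k₀ := key h₀ hPu hP
  have k₁ := key h₁ hQv hQ
  linarith

end WeakDuality

/-! ### Compact sets of positive semidefinite matrices -/

theorem isClosed_posSemidef {n : Type*} [Fintype n] :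
    IsClosed {M : Matrix n n ℂ | M.PosSemidef} := by
  have h : {M : Matrix n n ℂ | M.PosSemidef} =
      {M | Mᴴ = M} ∩ ⋂ x : n → ℂ, {M | 0 ≤ star x ⬝ᵥ (M *ᵥ x)} := by
    ext M
    simp [posSemidef_iff_dotProduct_mulVec, IsHermitian]
  rw [h]
  refine (isClosed_eq (by fun_prop) continuous_id).inter (isClosed_iInter fun x => ?_)
  exact isClosed_le continuous_const (by fun_prop)

theorem exists_eq_conjTranspose_mul_self {n : Type*} [Fintype n] [DecidableEq n]
    {M : Matrix n n ℂ} (hM : M.PosSemidef) : ∃ B : Matrix n n ℂ, M = Bᴴ * B := by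
  open scoped MatrixOrder Matrix.Norms.L2Operator in
  exact CStarAlgebra.nonneg_iff_eq_star_mul_self.1 hM.nonneg

/-- With `M = Bᴴ * B`, AM-GM bounds an entry by the mean of two diagonal entries. A trace bound
therefore gives boundedness, hence compactness. -/
theorem norm_apply_le_re_trace {n : Type*} [Fintype n] {M : Matrix n n ℂ}
    (hM : M.PosSemidef) (i j : n) : ‖M i j‖ ≤ M.trace.re := by
  classical
  obtain ⟨B, rfl⟩ := exists_eq_conjTranspose_mul_self hM
  have hd : ∀ i, ((Bᴴ * B) i i).re = ∑ k, ‖B k i‖ ^ 2 := by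
    intro i
    rw [mul_apply, Complex.re_sum]
    refine Finset.sum_congr rfl fun k _ => ?_
    have : Bᴴ i k * B k i = ((‖B k i‖ ^ 2 : ℝ) : ℂ) := by
      push_cast
      exact Complex.conj_mul' _
    rw [this, Complex.ofReal_re]
  have hle : ∀ i, ((Bᴴ * B) i i).re ≤ (Bᴴ * B).trace.re := by
    intro i
    rw [trace, Complex.re_sum]
    refine Finset.single_le_sum (f := fun i => ((Bᴴ * B) i i).re) (fun k _ => ?_)
      (Finset.mem_univ i)
    simp only [hd]
    positivity
  have h1 : ‖(Bᴴ * B) i j‖ ≤ ∑ k, (1 / 2 * ‖B k i‖ ^ 2 + 1 / 2 * ‖B k j‖ ^ 2) := by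
    rw [mul_apply]
    refine (norm_sum_le _ _).trans (Finset.sum_le_sum fun k _ => ?_)
    rw [norm_mul, conjTranspose_apply, norm_star]
    nlinarith [sq_nonneg (‖B k i‖ - ‖B k j‖)]
  rw [Finset.sum_add_distrib, ← Finset.mul_sum, ← Finset.mul_sum, ← hd, ← hd] at h1
  linarith [hle i, hle j]

open scoped Matrix.Norms.Elementwise in
theorem isCompact_posSemidef_trace_le {n : Type*} [Fintype n] (C : ℝ) :
    IsCompact {M : Matrix n n ℂ | M.PosSemidef ∧ M.trace.re ≤ C} := by
  have : ProperSpace (Matrix n n ℂ) := FiniteDimensional.proper ℝ _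
  refine Metric.isCompact_of_isClosed_isBounded ?_ ?_
  · exact isClosed_posSemidef.inter (isClosed_le (Complex.continuous_re.comp
      continuous_id.matrix_trace) continuous_const)
  · refine (Metric.isBounded_closedBall (x := (0 : Matrix n n ℂ)) (r := |C|)).subset ?_
    rintro M ⟨hM, hC⟩
    rw [mem_closedBall_zero_iff, Matrix.norm_le_iff (abs_nonneg C)]
    exact fun i j => (norm_apply_le_re_trace hM i j).trans (hC.trans (le_abs_self C))

/-- Density matrices. -/
def densityMatrices (n : Type*) [Fintype n] : Set (Matrix n n ℂ) :=
  {σ | σ.PosSemidef ∧ σ.trace = 1}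

theorem isCompact_densityMatrices (n : Type*) [Fintype n] : IsCompact (densityMatrices n) := by
  have h : densityMatrices n =
      {M : Matrix n n ℂ | M.PosSemidef ∧ M.trace.re ≤ 1} ∩ {M | M.trace = 1} := by
    ext M
    constructor
    · rintro ⟨h1, h2⟩
      exact ⟨⟨h1, by rw [h2]; simp⟩, h2⟩
    · rintro ⟨⟨h1, -⟩, h2⟩
      exact ⟨h1, h2⟩
  rw [h]
  exact (isCompact_posSemidef_trace_le 1).inter_right (isClosed_eq (by fun_prop) continuous_const)

theorem posSemidef_real_smul {n : Type*} {M : Matrix n n ℂ} (hM : M.PosSemidef) {t : ℝ}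
    (ht : 0 ≤ t) : (t • M).PosSemidef :=
  hM.smul ht

theorem convex_posSemidef (n : Type*) : Convex ℝ {M : Matrix n n ℂ | M.PosSemidef} :=
  fun _ hx _ hy _ _ hs ht _ =>
    (posSemidef_real_smul hx hs).add (posSemidef_real_smul hy ht)

theorem convex_densityMatrices (n : Type*) [Fintype n] : Convex ℝ (densityMatrices n) := by
  rintro x ⟨hx, hx1⟩ y ⟨hy, hy1⟩ s t hs ht hst
  refine ⟨convex_posSemidef n hx hy hs ht hst, ?_⟩
  rw [trace_add, trace_smul, trace_smul, hx1, hy1, ← add_smul, hst, one_smul]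

theorem densityMatrices_nonempty (n : Type*) [Fintype n] [DecidableEq n] [Nonempty n] :
    (densityMatrices n).Nonempty := by
  obtain ⟨i⟩ := ‹Nonempty n›
  refine ⟨diagonal (Pi.single i 1), PosSemidef.diagonal ?_, by simp [trace_diagonal]⟩
  rw [Pi.single_nonneg]
  exact zero_le_one

theorem re_trace_mul_nonneg {n : Type*} [Fintype n] {N σ : Matrix n n ℂ}
    (hN : N.PosSemidef) (hσ : σ.PosSemidef) : 0 ≤ (N * σ).trace.re := by
  classical
  obtain ⟨B, rfl⟩ := exists_eq_conjTranspose_mul_self hσ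
  rw [← Matrix.mul_assoc, trace_mul_comm, ← Matrix.mul_assoc]
  exact (Complex.le_def.1 (hN.mul_mul_conjTranspose_same B).trace_nonneg).1

theorem specNorm_le_of_forall_densityMatrices {n : Type*} [Fintype n] [DecidableEq n]
    {N : Matrix n n ℂ} (hN : N.PosSemidef) {t : ℝ} (ht : 0 ≤ t)
    (h : ∀ σ ∈ densityMatrices n, (N * σ).trace.re ≤ t) : specNorm N ≤ t := by
  rw [specNorm_le_iff hN ht]
  have hH : ((t : ℂ) • (1 : Matrix n n ℂ) - N).IsHermitian :=
    (posSemidef_real_smul PosSemidef.one ht).isHermitian.sub hN.isHermitian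
  refine PosSemidef.of_dotProduct_mulVec_nonneg hH fun x => ?_
  have hq : ∀ M : Matrix n n ℂ, star x ⬝ᵥ (M *ᵥ x) = (M * vecMulVec x (star x)).trace := by
    intro M
    rw [mul_vecMulVec, trace_vecMulVec, dotProduct_comm]
  by_cases hx : x = 0
  · simp [hx]
  set c : ℝ := (vecMulVec x (star x)).trace.re with hc
  have hps := posSemidef_vecMulVec_self_star x
  have hctr : (vecMulVec x (star x)).trace = (c : ℂ) := by
    have := Complex.le_def.1 hps.trace_nonneg
    exact Complex.ext rfl (by simpa using this.2.symm)
  have hcpos : 0 < c := by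
    have h1 : 0 < (vecMulVec x (star x)).trace := by
      rw [trace_vecMulVec]
      exact dotProduct_self_star_pos_iff.2 hx
    exact (Complex.lt_def.1 h1).1
  -- The test state is the normalised projector onto `x`.
  have hσ := h (c⁻¹ • vecMulVec x (star x))
    ⟨posSemidef_real_smul hps (inv_nonneg.2 hcpos.le), by
      rw [trace_smul, hctr, Complex.real_smul, ← Complex.ofReal_mul, inv_mul_cancel₀ hcpos.ne',
        Complex.ofReal_one]⟩
  rw [Matrix.mul_smul, trace_smul, Complex.smul_re, smul_eq_mul, inv_mul_le_iff₀ hcpos] at hσ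
  refine Complex.le_def.2 ⟨?_, ?_⟩
  · rw [hq, Matrix.sub_mul, Matrix.smul_mul, Matrix.one_mul, trace_sub, trace_smul, hctr]
    simp
    linarith
  · exact (hH.im_star_dotProduct_mulVec_self x).symm

/-! ### The minimax argument -/

/-- Sion's theorem with only `X` compact. The set `Y` may be unbounded, so its infimum need not be
attained and the conclusion carries an `ε`. -/
theorem exists_forall_lt_of_forall_exists_lt {E F : Type*} [TopologicalSpace E] [AddCommGroup E]
    [Module ℝ E] [IsTopologicalAddGroup E] [ContinuousSMul ℝ E] [TopologicalSpace F]
    [AddCommGroup F] [Module ℝ F] [IsTopologicalAddGroup F] [ContinuousSMul ℝ F]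
    {X : Set E} (ne_X : X.Nonempty) (cX : Convex ℝ X) (kX : IsCompact X)
    {Y : Set F} (cY : Convex ℝ Y) (B : E →ₗ[ℝ] F →ₗ[ℝ] ℝ)
    (hBx : ∀ y ∈ Y, Continuous fun x => B x y) (hBy : ∀ x ∈ X, Continuous (B x))
    (hB : ∀ x ∈ X, ∀ y ∈ Y, 0 ≤ B x y) {v : ℝ}
    (h : ∀ x ∈ X, ∀ ε > 0, ∃ y ∈ Y, B x y < v + ε) {ε : ℝ} (hε : 0 < ε) :
    ∃ y ∈ Y, ∀ x ∈ X, B x y < v + ε := by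
  obtain ⟨x₀, hx₀⟩ := ne_X
  obtain ⟨y₀, hy₀, -⟩ := h x₀ hx₀ 1 one_pos
  -- The sign flip puts the infimum on the compact side; nonnegativity of `B` bounds the suprema
  -- over `Y`.
  set f : E → F → ℝ := fun x y => - B x y with hf
  set supY : E → ℝ := fun x => sSup {f x y | y ∈ Y} with hsupY
  set infX : F → ℝ := fun y => sInf {f x y | x ∈ X} with hinfX
  have hsup : ∀ x ∈ X, IsLUB {f x y | y ∈ Y} (supY x) := fun x hx =>
    Real.isLUB_sSup ⟨_, y₀, hy₀, rfl⟩ ⟨0, by rintro _ ⟨y, hy, rfl⟩; simpa [hf] using hB x hx y hy⟩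
  have hinf : ∀ y ∈ Y, IsGLB {f x y | x ∈ X} (infX y) := fun y hy =>
    Real.isGLB_sInf ⟨_, x₀, hx₀, rfl⟩ (kX.image (hBx y hy).neg).bddBelow
  have hv : ∀ x ∈ X, -v ≤ supY x := by
    intro x hx
    refine le_of_forall_pos_le_add fun δ hδ => ?_
    obtain ⟨y, hy, hlt⟩ := h x hx δ hδ
    have := (hsup x hx).1 ⟨y, hy, rfl⟩
    simp only [hf] at this
    linarith
  have hinfsup : IsGLB {supY x | x ∈ X} (sInf {supY x | x ∈ X}) :=
    Real.isGLB_sInf ⟨_, x₀, hx₀, rfl⟩ ⟨-v, by rintro _ ⟨x, hx, rfl⟩; exact hv x hx⟩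
  have hsupinf : IsLUB {infX y | y ∈ Y} (sSup {infX y | y ∈ Y}) := by
    refine Real.isLUB_sSup ⟨_, y₀, hy₀, rfl⟩ ⟨0, ?_⟩
    rintro _ ⟨y, hy, rfl⟩
    refine ((hinf y hy).1 ⟨x₀, hx₀, rfl⟩).trans ?_
    simpa [hf] using hB x₀ hx₀ y hy
  have hmm := Sion.minimax (f := f) ⟨x₀, hx₀⟩ kX
    (fun y hy => ((hBx y hy).neg.lowerSemicontinuous).lowerSemicontinuousOn _)
    (fun y hy => ((-(B.flip y)).convexOn cX).quasiconvexOn) cY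
    (fun x hx => ((hBy x hx).neg.upperSemicontinuous).upperSemicontinuousOn _)
    (fun x hx => ((-(B x)).concaveOn cY).quasiconcaveOn) cX
    supY hsup _ hinfsup infX hinf _ hsupinf
  have h1 : -v ≤ sInf {supY x | x ∈ X} :=
    (le_isGLB_iff hinfsup).2 (by rintro _ ⟨x, hx, rfl⟩; exact hv x hx)
  obtain ⟨_, ⟨y, hy, rfl⟩, hlt, -⟩ := hsupinf.exists_between
    (show -v - ε < sSup {infX y | y ∈ Y} by linarith)
  refine ⟨y, hy, fun x hx => ?_⟩
  have := (hinf y hy).1 ⟨x, hx, rfl⟩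
  simp only [hf] at this
  linarith

section StrongDuality

variable {a b ι : Type*} [Fintype a] [DecidableEq a] [Fintype b] [DecidableEq b] [Fintype ι]

/-! ### Strong duality for the diamond norm -/

/-- The pairs `(Y₀, Y₁)` that are feasible for the dual program of the diamond norm of `Φ`. -/
def dualFeasible (Φ : Matrix a a ℂ →ₗ[ℂ] Matrix b b ℂ) :
    Set (Matrix (b × a) (b × a) ℂ × Matrix (b × a) (b × a) ℂ) :=
  {Y | (fromBlocks Y.1 (choi Φ) (choi Φ)ᴴ Y.2).PosSemidef}

theorem posSemidef_fst_of_fromBlocks {n : Type*} {P T Q : Matrix n n ℂ}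
    (h : (fromBlocks P T Tᴴ Q).PosSemidef) : P.PosSemidef := h.submatrix Sum.inl

theorem posSemidef_snd_of_fromBlocks {n : Type*} {P T Q : Matrix n n ℂ}
    (h : (fromBlocks P T Tᴴ Q).PosSemidef) : Q.PosSemidef := h.submatrix Sum.inr

theorem dualFeasible_nonempty (Φ : Matrix a a ℂ →ₗ[ℂ] Matrix b b ℂ) :
    (dualFeasible Φ).Nonempty := by
  obtain ⟨P, Q, h, -⟩ := exists_posSemidef_fromBlocks_trace_eq (choi Φ)
  exact ⟨(P, Q), h⟩

theorem traceNorm_nonneg {r : Type*} [Fintype r] [DecidableEq r] (X : Matrix r r ℂ) :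
    0 ≤ traceNorm X :=
  Finset.sum_nonneg fun _ _ => Real.sqrt_nonneg _

theorem diamondNorm_nonneg (Φ : Matrix a a ℂ →ₗ[ℂ] Matrix b b ℂ) : 0 ≤ diamondNorm Φ :=
  Real.sSup_nonneg (by rintro _ ⟨X, -, rfl⟩; exact traceNorm_nonneg _)

theorem mem_upperBounds_of_dualFeasible {Φ : Matrix a a ℂ →ₗ[ℂ] Matrix b b ℂ}
    {Y : Matrix (b × a) (b × a) ℂ × Matrix (b × a) (b × a) ℂ} (hY : Y ∈ dualFeasible Φ) :
    1 / 2 * specNorm (partialTraceB Y.1) + 1 / 2 * specNorm (partialTraceB Y.2) ∈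
      upperBounds {t : ℝ | ∃ X : Matrix (a × a) (a × a) ℂ,
        traceNorm X ≤ 1 ∧ t = traceNorm (tensorId Φ X)} := by
  rintro _ ⟨X, hX, rfl⟩
  exact traceNorm_tensorId_le (posSemidef_fst_of_fromBlocks hY) (posSemidef_snd_of_fromBlocks hY)
    hY hX

theorem diamondNorm_le_of_dualFeasible {Φ : Matrix a a ℂ →ₗ[ℂ] Matrix b b ℂ}
    {Y : Matrix (b × a) (b × a) ℂ × Matrix (b × a) (b × a) ℂ} (hY : Y ∈ dualFeasible Φ) :
    diamondNorm Φ ≤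
      1 / 2 * specNorm (partialTraceB Y.1) + 1 / 2 * specNorm (partialTraceB Y.2) :=
  Real.sSup_le (mem_upperBounds_of_dualFeasible hY)
    (by linarith [specNorm_nonneg (partialTraceB Y.1), specNorm_nonneg (partialTraceB Y.2)])

theorem traceNorm_tensorId_le_diamondNorm (Φ : Matrix a a ℂ →ₗ[ℂ] Matrix b b ℂ)
    {X : Matrix (a × a) (a × a) ℂ} (hX : traceNorm X ≤ 1) :
    traceNorm (tensorId Φ X) ≤ diamondNorm Φ := by
  -- A feasible point bounds the defining set, so `sSup` is a genuine supremum and not the default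
  -- `0`.
  obtain ⟨Y, hY⟩ := dualFeasible_nonempty Φ
  exact le_csSup ⟨_, mem_upperBounds_of_dualFeasible hY⟩ ⟨X, hX, rfl⟩

theorem traceNorm_vecMulVec_le {r : Type*} [Fintype r] [DecidableEq r] (u v : r → ℂ) :
    traceNorm (vecMulVec u (star v)) ≤
      1 / 2 * (vecMulVec u (star u)).trace.re + 1 / 2 * (vecMulVec v (star v)).trace.re := by
  refine traceNorm_le_of_posSemidef_fromBlocks ?_
  convert posSemidef_vecMulVec_self_star (Sum.elim u v) using 1
  ext (i | i) (j | j) <;> simp [vecMulVec_apply]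

/-- For positive definite density matrices, the dual program weighted by them attains the trace
norm of an output of `Φ ⊗ id`. -/
theorem exists_dualFeasible_le_of_posDef (Φ : Matrix a a ℂ →ₗ[ℂ] Matrix b b ℂ)
    {σ₀ σ₁ : Matrix a a ℂ} (h₀ : σ₀.PosDef) (h₁ : σ₁.PosDef) (t₀ : σ₀.trace = 1)
    (t₁ : σ₁.trace = 1) :
    ∃ Y ∈ dualFeasible Φ, 1 / 2 * (partialTraceB Y.1 * σ₀).trace.re +
      1 / 2 * (partialTraceB Y.2 * σ₁).trace.re ≤ diamondNorm Φ := by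
  obtain ⟨M₀, hM₀⟩ := exists_eq_conjTranspose_mul_self h₀.posSemidef
  obtain ⟨M₁, hM₁⟩ := exists_eq_conjTranspose_mul_self h₁.posSemidef
  have hinv : ∀ {σ M : Matrix a a ℂ}, σ.PosDef → σ = Mᴴ * M → M⁻¹ * M = 1 := by
    intro σ M hσ hM
    refine nonsing_inv_mul _ ((isUnit_iff_isUnit_det _).1 ?_)
    exact isUnit_of_mul_isUnit_right (hM ▸ hσ.isUnit)
  have hi₀ := hinv h₀ hM₀
  have hi₁ := hinv h₁ hM₁
  set u : a × a → ℂ := fun i => M₀ i.2 i.1 with hu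
  set v : a × a → ℂ := fun i => M₁ i.2 i.1 with hv
  have hMu : vecToMat u = M₀ := rfl
  have hMv : vecToMat v = M₁ := rfl
  have htu : (vecMulVec u (star u)).trace = 1 := by
    rw [← trace_vecToMat_mul_conjTranspose, hMu, trace_mul_comm, ← hM₀, t₀]
  have htv : (vecMulVec v (star v)).trace = 1 := by
    rw [← trace_vecToMat_mul_conjTranspose, hMv, trace_mul_comm, ← hM₁, t₁]
  have hX : traceNorm (vecMulVec u (star v)) ≤ 1 := by
    refine (traceNorm_vecMulVec_le u v).trans ?_
    rw [htu, htv]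
    norm_num
  obtain ⟨P, Q, hPQ, hP, hQ⟩ := exists_posSemidef_fromBlocks_trace_eq
    (tensorId Φ (vecMulVec u (star v)))
  set K₀ : Matrix (b × a) (b × a) ℂ := (1 : Matrix b b ℂ) ⊗ₖ M₀ with hK₀
  set K₁ : Matrix (b × a) (b × a) ℂ := (1 : Matrix b b ℂ) ⊗ₖ M₁ with hK₁
  set L₀ : Matrix (b × a) (b × a) ℂ := (1 : Matrix b b ℂ) ⊗ₖ M₀⁻¹ with hL₀
  set L₁ : Matrix (b × a) (b × a) ℂ := (1 : Matrix b b ℂ) ⊗ₖ M₁⁻¹ with hL₁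
  have e₀ : L₀ * K₀ = 1 := by
    rw [hL₀, hK₀, ← mul_kronecker_mul, hi₀, Matrix.one_mul, one_kronecker_one]
  have e₁ : L₁ * K₁ = 1 := by
    rw [hL₁, hK₁, ← mul_kronecker_mul, hi₁, Matrix.one_mul, one_kronecker_one]
  -- Invertibility of `σ₀`, `σ₁` is used here: undoing the congruence turns the optimal block matrix
  -- around the output into one around `choi Φ`.
  have hTJ : L₀ * tensorId Φ (vecMulVec u (star v)) * L₁ᴴ = choi Φ := by
    rw [tensorId_vecMulVec, hMu, hMv, ← hK₀, ← hK₁, Matrix.mul_assoc, Matrix.mul_assoc,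
      Matrix.mul_assoc, ← conjTranspose_mul, e₁, conjTranspose_one, Matrix.mul_one,
      ← Matrix.mul_assoc, e₀, Matrix.one_mul]
  have hfeas := posSemidef_fromBlocks_mul hPQ L₀ L₁
  rw [hTJ] at hfeas
  have htr : ∀ {σ M : Matrix a a ℂ} {K L R : Matrix (b × a) (b × a) ℂ}, σ = Mᴴ * M →
      K = (1 : Matrix b b ℂ) ⊗ₖ M → L * K = 1 →
      (partialTraceB (L * R * Lᴴ) * σ).trace = R.trace := by
    intro σ M K L R hσ hK hLK
    have hKL : K * L = 1 := mul_eq_one_comm.1 hLK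
    rw [hσ, ← Matrix.mul_assoc, trace_mul_comm, ← Matrix.mul_assoc,
      ← trace_kronecker_mul_mul_conjTranspose, ← hK, Matrix.mul_assoc, Matrix.mul_assoc,
      ← conjTranspose_mul, hKL, conjTranspose_one, Matrix.mul_one, ← Matrix.mul_assoc, hKL,
      Matrix.one_mul]
  refine ⟨(L₀ * P * L₀ᴴ, L₁ * Q * L₁ᴴ), hfeas, ?_⟩
  rw [htr hM₀ hK₀ e₀, htr hM₁ hK₁ e₁, hP, hQ, Complex.ofReal_re]
  linarith [traceNorm_tensorId_le_diamondNorm Φ hX]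

/-- Every density matrix is dominated, up to a factor close to `1`, by an invertible one. -/
theorem exists_posDef_densityMatrix {σ : Matrix a a ℂ} [Nonempty a] (hσ : σ ∈ densityMatrices a)
    {δ : ℝ} (hδ : 0 < δ) :
    ∃ τ : Matrix a a ℂ, τ.PosDef ∧ τ.trace = 1 ∧
      ∀ N : Matrix a a ℂ, N.PosSemidef →
        (N * σ).trace.re ≤ (1 + δ) * (N * τ).trace.re := by
  have hcard : (0 : ℝ) < Fintype.card a := by exact_mod_cast Fintype.card_pos
  have h1 : (0 : ℝ) < 1 + δ := by linarith
  have hpd : ((δ / Fintype.card a : ℝ) • (1 : Matrix a a ℂ)).PosDef :=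
    PosDef.one.smul (div_pos hδ hcard)
  refine ⟨(1 + δ)⁻¹ • (σ + (δ / Fintype.card a : ℝ) • (1 : Matrix a a ℂ)),
    (PosDef.posSemidef_add hσ.1 hpd).smul (inv_pos.2 h1), ?_, fun N hN => ?_⟩
  · rw [trace_smul, trace_add, trace_smul, hσ.2, trace_one]
    have hc : (Fintype.card a : ℂ) ≠ 0 := by exact_mod_cast hcard.ne'
    have h2 : (1 + δ : ℂ) ≠ 0 := by exact_mod_cast h1.ne'
    simp only [Complex.real_smul]
    push_cast
    field_simp
  · rw [Matrix.mul_smul, trace_smul, Complex.smul_re, smul_eq_mul, mul_inv_cancel_left₀ h1.ne',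
      Matrix.mul_add, trace_add, Complex.add_re]
    linarith [re_trace_mul_nonneg hN hpd.posSemidef]

theorem exists_dualFeasible_lt (Φ : Matrix a a ℂ →ₗ[ℂ] Matrix b b ℂ)
    {σ₀ σ₁ : Matrix a a ℂ} (h₀ : σ₀ ∈ densityMatrices a) (h₁ : σ₁ ∈ densityMatrices a)
    [Nonempty a] {ε : ℝ} (hε : 0 < ε) :
    ∃ Y ∈ dualFeasible Φ, 1 / 2 * (partialTraceB Y.1 * σ₀).trace.re +
      1 / 2 * (partialTraceB Y.2 * σ₁).trace.re < diamondNorm Φ + ε := by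
  have hD := diamondNorm_nonneg Φ
  -- With this choice `(1 + δ) * diamondNorm Φ = diamondNorm Φ + ε - δ`, which keeps the bound
  -- strict.
  set δ : ℝ := ε / (diamondNorm Φ + 1) with hδ
  have hδpos : 0 < δ := by positivity
  obtain ⟨τ₀, p₀, t₀, d₀⟩ := exists_posDef_densityMatrix h₀ hδpos
  obtain ⟨τ₁, p₁, t₁, d₁⟩ := exists_posDef_densityMatrix h₁ hδpos
  obtain ⟨Y, hY, hle⟩ := exists_dualFeasible_le_of_posDef Φ p₀ p₁ t₀ t₁
  refine ⟨Y, hY, ?_⟩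
  have e₀ := d₀ _ (posSemidef_partialTraceB (posSemidef_fst_of_fromBlocks hY))
  have e₁ := d₁ _ (posSemidef_partialTraceB (posSemidef_snd_of_fromBlocks hY))
  have h2 := mul_le_mul_of_nonneg_left hle (show 0 ≤ 1 + δ by linarith)
  have h3 : δ * (diamondNorm Φ + 1) = ε := by rw [hδ]; field_simp
  nlinarith

omit [Fintype a] [DecidableEq a] [DecidableEq b] in
theorem partialTraceB_add (Y Z : Matrix (b × a) (b × a) ℂ) :
    partialTraceB (Y + Z) = partialTraceB Y + partialTraceB Z := by
  ext p q
  simp [partialTraceB, Finset.sum_add_distrib]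

omit [Fintype a] [DecidableEq a] [DecidableEq b] in
theorem partialTraceB_smul (t : ℝ) (Y : Matrix (b × a) (b × a) ℂ) :
    partialTraceB (t • Y) = t • partialTraceB Y := by
  ext p q
  simp [partialTraceB, Finset.mul_sum]

/-- The real bilinear pairing `(σ, Y) ↦ ½ Re tr(tr_B Y₀ σ₀) + ½ Re tr(tr_B Y₁ σ₁)`. -/
def dualPairing (a b : Type*) [Fintype a] [Fintype b] :
    (Matrix a a ℂ × Matrix a a ℂ) →ₗ[ℝ]
      (Matrix (b × a) (b × a) ℂ × Matrix (b × a) (b × a) ℂ) →ₗ[ℝ] ℝ :=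
  LinearMap.mk₂ ℝ (fun σ Y => 1 / 2 * (partialTraceB Y.1 * σ.1).trace.re +
      1 / 2 * (partialTraceB Y.2 * σ.2).trace.re)
    (fun σ τ Y => by simp [Matrix.mul_add]; ring)
    (fun t σ Y => by simp; ring)
    (fun σ Y Z => by simp [partialTraceB_add, Matrix.add_mul]; ring)
    (fun t σ Y => by simp [partialTraceB_smul]; ring)

omit [Fintype a] [Fintype b] [DecidableEq b] in
theorem convex_dualFeasible (Φ : Matrix a a ℂ →ₗ[ℂ] Matrix b b ℂ) :
    Convex ℝ (dualFeasible Φ) := by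
  intro Y hY Z hZ s t hs ht hst
  have h := convex_posSemidef _ hY hZ hs ht hst
  have e : s • choi Φ + t • choi Φ = choi Φ := by rw [← add_smul, hst, one_smul]
  have e' : s • (choi Φ)ᴴ + t • (choi Φ)ᴴ = (choi Φ)ᴴ := by rw [← add_smul, hst, one_smul]
  rw [Set.mem_ofPred_eq, fromBlocks_smul, fromBlocks_smul, fromBlocks_add, e, e'] at h
  exact h

/-- The dual program comes arbitrarily close to the diamond norm. -/
theorem exists_dualFeasible_specNorm_le (Φ : Matrix a a ℂ →ₗ[ℂ] Matrix b b ℂ) {ε : ℝ}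
    (hε : 0 < ε) :
    ∃ Y ∈ dualFeasible Φ, 1 / 2 * specNorm (partialTraceB Y.1) +
      1 / 2 * specNorm (partialTraceB Y.2) ≤ diamondNorm Φ + ε := by
  -- If `A` is zero-dimensional there are no density matrices, so the minimax argument does not
  -- apply.
  rcases isEmpty_or_nonempty a with ha | ha
  · obtain ⟨Y, hY⟩ := dualFeasible_nonempty Φ
    have h : ∀ N : Matrix a a ℂ, specNorm N = 0 := fun N => by
      rw [Subsingleton.elim N 0, specNorm, map_zero, norm_zero]
    refine ⟨Y, hY, ?_⟩
    rw [h, h]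
    linarith [diamondNorm_nonneg Φ]
  have hps : ∀ Y ∈ dualFeasible Φ,
      (partialTraceB Y.1).PosSemidef ∧ (partialTraceB Y.2).PosSemidef := fun Y hY =>
    ⟨posSemidef_partialTraceB (posSemidef_fst_of_fromBlocks hY),
      posSemidef_partialTraceB (posSemidef_snd_of_fromBlocks hY)⟩
  obtain ⟨Y, hY, hlt⟩ := exists_forall_lt_of_forall_exists_lt
    (X := densityMatrices a ×ˢ densityMatrices a) (Y := dualFeasible Φ) (v := diamondNorm Φ)
    ((densityMatrices_nonempty a).prod (densityMatrices_nonempty a))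
    ((convex_densityMatrices a).prod (convex_densityMatrices a))
    ((isCompact_densityMatrices a).prod (isCompact_densityMatrices a))
    (convex_dualFeasible Φ) (dualPairing a b)
    (fun Y _ => ((dualPairing a b).flip Y).continuous_of_finiteDimensional)
    (fun σ _ => (dualPairing a b σ).continuous_of_finiteDimensional)
    (fun σ hσ Y hY => by
      have e₀ := re_trace_mul_nonneg (hps Y hY).1 hσ.1.1
      have e₁ := re_trace_mul_nonneg (hps Y hY).2 hσ.2.1
      simp only [dualPairing, LinearMap.mk₂_apply]
      linarith)
    (fun σ hσ ε hε => exists_dualFeasible_lt Φ hσ.1 hσ.2 hε) hε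
  refine ⟨Y, hY, ?_⟩
  obtain ⟨hp₀, hp₁⟩ := hps Y hY
  have hlt' : ∀ σ₀ ∈ densityMatrices a, ∀ σ₁ ∈ densityMatrices a,
      1 / 2 * (partialTraceB Y.1 * σ₀).trace.re +
        1 / 2 * (partialTraceB Y.2 * σ₁).trace.re < diamondNorm Φ + ε :=
    fun σ₀ h₀ σ₁ h₁ => hlt (σ₀, σ₁) ⟨h₀, h₁⟩
  obtain ⟨ρ, hρ⟩ := densityMatrices_nonempty a
  -- The supremum over pairs separates: first over `σ₀` with `σ₁` fixed, then over `σ₁`. The state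
  -- `ρ` only certifies that the bounds are nonnegative.
  have h1 : ∀ σ₁ ∈ densityMatrices a, specNorm (partialTraceB Y.1) ≤
      2 * (diamondNorm Φ + ε) - (partialTraceB Y.2 * σ₁).trace.re := by
    intro σ₁ h₁
    refine specNorm_le_of_forall_densityMatrices hp₀ ?_ fun σ₀ h₀ => ?_
    · linarith [hlt' ρ hρ σ₁ h₁, re_trace_mul_nonneg hp₀ hρ.1]
    · linarith [hlt' σ₀ h₀ σ₁ h₁]
  have h2 : specNorm (partialTraceB Y.2) ≤
      2 * (diamondNorm Φ + ε) - specNorm (partialTraceB Y.1) := by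
    refine specNorm_le_of_forall_densityMatrices hp₁ ?_ fun σ₁ h₁ => ?_
    · linarith [h1 ρ hρ, re_trace_mul_nonneg hp₁ hρ.1]
    · linarith [h1 σ₁ h₁]
  linarith

/-! ### Attainment in the semidefinite program -/

theorem continuous_specNorm {n : Type*} [Fintype n] [DecidableEq n] :
    Continuous (specNorm : Matrix n n ℂ → ℝ) :=
  ((toEuclideanCLM (n := n) (𝕜 := ℂ)).toAlgEquiv.toLinearEquiv.toLinearMap
    ).continuous_of_finiteDimensional.norm

omit [Fintype a] [DecidableEq a] [DecidableEq b] in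
theorem continuous_partialTraceB : Continuous (partialTraceB : Matrix (b × a) (b × a) ℂ → _) :=
  continuous_matrix fun _ _ => continuous_finsetSum _ fun _ _ =>
    continuous_id.matrix_elem _ _

omit [DecidableEq b] [Fintype ι] in
theorem continuous_sdpObjective : Continuous (sdpObjective : SDPVar a b ι → ℝ) := by
  have h := continuous_specNorm.comp (continuous_partialTraceB (a := a) (b := b))
  exact (continuous_const.mul (h.comp (continuous_fst.comp continuous_snd))).add
    (continuous_const.mul (h.comp (continuous_snd.comp continuous_snd)))

omit [DecidableEq b] in
theorem isClosed_sdpFeasible (U : Matrix a a ℂ →ₗ[ℂ] Matrix b b ℂ)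
    (E : ι → Matrix a a ℂ →ₗ[ℂ] Matrix b b ℂ) (γ : ℝ) : IsClosed (sdpFeasible U E γ) := by
  have h1 : Continuous fun z : SDPVar a b ι => fromBlocks z.2.1
      (∑ i, (z.1 i : ℂ) • choi (E i) - choi U)
      (∑ i, (z.1 i : ℂ) • (choi (E i)).conjTranspose - (choi U).conjTranspose) z.2.2 := by
    fun_prop
  have h2 : Continuous fun z : SDPVar a b ι => gammaFactor z.1 := by
    unfold gammaFactor
    fun_prop
  exact (isClosed_posSemidef.preimage h1).inter <| (isClosed_le h2 continuous_const).inter <|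
    (isClosed_posSemidef.preimage (continuous_fst.comp continuous_snd)).inter
      (isClosed_posSemidef.preimage (continuous_snd.comp continuous_snd))

omit [DecidableEq b] in
theorem re_trace_le_specNorm_partialTraceB {Y : Matrix (b × a) (b × a) ℂ} (hY : Y.PosSemidef) :
    Y.trace.re ≤ specNorm (partialTraceB Y) * Fintype.card a := by
  have h := re_trace_mul_mul_conjTranspose_le (posSemidef_partialTraceB hY) (1 : Matrix a a ℂ)
  simpa [trace_partialTraceB] using h

omit [DecidableEq b] in
theorem isCompact_sdpFeasible_sublevel (U : Matrix a a ℂ →ₗ[ℂ] Matrix b b ℂ)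
    (E : ι → Matrix a a ℂ →ₗ[ℂ] Matrix b b ℂ) (γ M : ℝ) :
    IsCompact {z ∈ sdpFeasible U E γ | sdpObjective z ≤ M} := by
  -- Objective at most `M` forces each spectral norm below `2 * M`, and the trace of `Y` is at most
  -- that norm times `dim A`.
  set C : ℝ := 2 * M * Fintype.card a with hC
  have hK : IsCompact (Metric.closedBall (0 : ι → ℝ) |γ| ×ˢ
      ({Y : Matrix (b × a) (b × a) ℂ | Y.PosSemidef ∧ Y.trace.re ≤ C} ×ˢ
        {Y : Matrix (b × a) (b × a) ℂ | Y.PosSemidef ∧ Y.trace.re ≤ C})) :=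
    (isCompact_closedBall _ _).prod
      ((isCompact_posSemidef_trace_le C).prod (isCompact_posSemidef_trace_le C))
  refine hK.of_isClosed_subset ((isClosed_sdpFeasible U E γ).inter
    (isClosed_le continuous_sdpObjective continuous_const)) ?_
  rintro z ⟨⟨-, hγ, h₀, h₁⟩, hM⟩
  have hcard : (0 : ℝ) ≤ Fintype.card a := Nat.cast_nonneg _
  have n₀ := specNorm_nonneg (partialTraceB z.2.1)
  have n₁ := specNorm_nonneg (partialTraceB z.2.2)
  simp only [sdpObjective] at hM
  refine ⟨?_, ⟨h₀, ?_⟩, ⟨h₁, ?_⟩⟩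
  · rw [mem_closedBall_zero_iff, pi_norm_le_iff_of_nonneg (abs_nonneg γ)]
    intro i
    refine le_trans ?_ (hγ.trans (le_abs_self γ))
    exact Finset.single_le_sum (f := fun i => |z.1 i|) (fun _ _ => abs_nonneg _)
      (Finset.mem_univ i)
  · exact (re_trace_le_specNorm_partialTraceB h₀).trans
      (mul_le_mul_of_nonneg_right (by linarith) hcard)
  · exact (re_trace_le_specNorm_partialTraceB h₁).trans
      (mul_le_mul_of_nonneg_right (by linarith) hcard)

-- The closed set `K` of coefficients covers both uses: a singleton for fixed coefficients,
-- everything for the full program.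
omit [DecidableEq b] in
theorem exists_isMinOn_sdpObjective (U : Matrix a a ℂ →ₗ[ℂ] Matrix b b ℂ)
    (E : ι → Matrix a a ℂ →ₗ[ℂ] Matrix b b ℂ) (γ : ℝ) {K : Set (ι → ℝ)} (hK : IsClosed K)
    (hne : {z ∈ sdpFeasible U E γ | z.1 ∈ K}.Nonempty) :
    ∃ z ∈ {z ∈ sdpFeasible U E γ | z.1 ∈ K},
      IsMinOn sdpObjective {z ∈ sdpFeasible U E γ | z.1 ∈ K} z := by
  obtain ⟨w, hw, hwK⟩ := hne
  obtain ⟨z, ⟨⟨hz, -⟩, hzK⟩, hmin⟩ :=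
    ((isCompact_sdpFeasible_sublevel U E γ (sdpObjective w)).inter_right
      (hK.preimage continuous_fst)).exists_isMinOn ⟨w, ⟨hw, le_rfl⟩, hwK⟩
      continuous_sdpObjective.continuousOn
  refine ⟨z, ⟨hz, hzK⟩, fun y hy => ?_⟩
  rcases le_total (sdpObjective y) (sdpObjective w) with h | h
  · exact hmin ⟨⟨hy.1, h⟩, hy.2⟩
  · exact (hmin (show w ∈ _ from ⟨⟨hw, le_rfl⟩, hwK⟩) : sdpObjective z ≤ sdpObjective w).trans h

/-! ### The two problems -/

/-- The off-diagonal block in (S) is minus the Choi matrix of the error map, a sign removed by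
conjugating with `diag(1, -1)`; positivity of the diagonal blocks is automatic. -/
theorem mem_sdpFeasible_iff {U : Matrix a a ℂ →ₗ[ℂ] Matrix b b ℂ}
    {E : ι → Matrix a a ℂ →ₗ[ℂ] Matrix b b ℂ} {γ : ℝ} {z : SDPVar a b ι} :
    z ∈ sdpFeasible U E γ ↔
      gammaFactor z.1 ≤ γ ∧ z.2 ∈ dualFeasible (U - ∑ i, (z.1 i : ℂ) • E i) := by
  have e : ∑ i, (z.1 i : ℂ) • choi (E i) - choi U = -choi (U - ∑ i, (z.1 i : ℂ) • E i) := by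
    ext i j
    simp [choi, Matrix.sum_apply]
  have e' : ∑ i, (z.1 i : ℂ) • (choi (E i)).conjTranspose - (choi U).conjTranspose =
      (-choi (U - ∑ i, (z.1 i : ℂ) • E i))ᴴ := by
    rw [← e, conjTranspose_sub, conjTranspose_sum]
    simp
  rw [sdpFeasible, Set.mem_ofPred_eq, e, e']
  constructor
  · rintro ⟨h, hγ, -, -⟩
    have h2 := posSemidef_fromBlocks_neg h
    rw [neg_neg] at h2
    exact ⟨hγ, h2⟩
  · rintro ⟨hγ, h⟩
    exact ⟨posSemidef_fromBlocks_neg h, hγ, posSemidef_fst_of_fromBlocks h,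
      posSemidef_snd_of_fromBlocks h⟩

theorem budgetObjective_le_sdpObjective {U : Matrix a a ℂ →ₗ[ℂ] Matrix b b ℂ}
    {E : ι → Matrix a a ℂ →ₗ[ℂ] Matrix b b ℂ} {γ : ℝ} {z : SDPVar a b ι}
    (hz : z ∈ sdpFeasible U E γ) : budgetObjective U E z.1 ≤ sdpObjective z :=
  diamondNorm_le_of_dualFeasible (mem_sdpFeasible_iff.1 hz).2

theorem isLeast_sdpObjective_of_coeff (U : Matrix a a ℂ →ₗ[ℂ] Matrix b b ℂ)
    (E : ι → Matrix a a ℂ →ₗ[ℂ] Matrix b b ℂ) {γ : ℝ} {c : ι → ℝ}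
    (hc : c ∈ budgetFeasible ι γ) :
    IsLeast (sdpObjective '' {z ∈ sdpFeasible U E γ | z.1 = c}) (budgetObjective U E c) := by
  have hlb : budgetObjective U E c ∈
      lowerBounds (sdpObjective '' {z ∈ sdpFeasible U E γ | z.1 = c}) := by
    rintro _ ⟨z, ⟨hz, rfl⟩, rfl⟩
    exact budgetObjective_le_sdpObjective hz
  have happ : ∀ ε > 0, ∃ z ∈ {z ∈ sdpFeasible U E γ | z.1 = c},
      sdpObjective z ≤ budgetObjective U E c + ε := by
    intro ε hε
    obtain ⟨Y, hY, hle⟩ := exists_dualFeasible_specNorm_le (U - ∑ i, (c i : ℂ) • E i) hε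
    exact ⟨(c, Y), ⟨mem_sdpFeasible_iff.2 ⟨hc, hY⟩, rfl⟩, hle⟩
  obtain ⟨w, hw, -⟩ := happ 1 one_pos
  obtain ⟨z, hz, hmin⟩ := exists_isMinOn_sdpObjective U E γ (isClosed_singleton (x := c)) ⟨w, hw⟩
  refine ⟨⟨z, hz, le_antisymm ?_ (hlb ⟨z, hz, rfl⟩)⟩, hlb⟩
  refine le_of_forall_pos_le_add fun ε hε => ?_
  obtain ⟨y, hy, hle⟩ := happ ε hε
  exact (hmin hy : sdpObjective z ≤ sdpObjective y).trans hle

theorem isMinOn_budgetObjective_iff (U : Matrix a a ℂ →ₗ[ℂ] Matrix b b ℂ)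
    (E : ι → Matrix a a ℂ →ₗ[ℂ] Matrix b b ℂ) (γ : ℝ) (c : ι → ℝ) :
    (c ∈ budgetFeasible ι γ ∧ IsMinOn (budgetObjective U E) (budgetFeasible ι γ) c) ↔
      ∃ z ∈ sdpFeasible U E γ, IsMinOn sdpObjective (sdpFeasible U E γ) z ∧ z.1 = c := by
  constructor
  · rintro ⟨hc, hmin⟩
    obtain ⟨⟨z, ⟨hz, hzc⟩, hval⟩, -⟩ := isLeast_sdpObjective_of_coeff U E hc
    refine ⟨z, hz, fun y hy => ?_, hzc⟩
    have h1 : budgetObjective U E c ≤ budgetObjective U E y.1 :=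
      hmin (mem_sdpFeasible_iff.1 hy).1
    exact hval.le.trans (h1.trans (budgetObjective_le_sdpObjective hy))
  · rintro ⟨z, hz, hmin, rfl⟩
    refine ⟨(mem_sdpFeasible_iff.1 hz).1, fun c hc => ?_⟩
    obtain ⟨⟨y, ⟨hy, -⟩, hval⟩, -⟩ := isLeast_sdpObjective_of_coeff U E hc
    have h1 : sdpObjective z ≤ sdpObjective y := hmin hy
    exact (budgetObjective_le_sdpObjective hz).trans (h1.trans hval.le)

/-- Attainment in (P) is inherited from (S), so continuity of the diamond norm is not needed. -/
theorem exists_isLeast_budgetObjective_and_sdpObjective (U : Matrix a a ℂ →ₗ[ℂ] Matrix b b ℂ)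
    (E : ι → Matrix a a ℂ →ₗ[ℂ] Matrix b b ℂ) {γ : ℝ} (hγ : 0 ≤ γ) :
    ∃ v : ℝ, IsLeast (budgetObjective U E '' budgetFeasible ι γ) v ∧
      IsLeast (sdpObjective '' sdpFeasible U E γ) v := by
  have h0 : (0 : ι → ℝ) ∈ budgetFeasible ι γ := by simpa [budgetFeasible, gammaFactor] using hγ
  obtain ⟨⟨w, ⟨hw, -⟩, -⟩, -⟩ := isLeast_sdpObjective_of_coeff U E h0
  obtain ⟨z, ⟨hz, -⟩, hmin⟩ :=
    exists_isMinOn_sdpObjective U E γ isClosed_univ ⟨w, hw, Set.mem_univ _⟩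
  have hmin' : IsMinOn sdpObjective (sdpFeasible U E γ) z :=
    fun y hy => hmin ⟨hy, Set.mem_univ _⟩
  obtain ⟨hc, hcmin⟩ := (isMinOn_budgetObjective_iff U E γ z.1).2 ⟨z, hz, hmin', rfl⟩
  have hval : budgetObjective U E z.1 = sdpObjective z := by
    refine le_antisymm (budgetObjective_le_sdpObjective hz) ?_
    obtain ⟨⟨y, ⟨hy, -⟩, hy'⟩, -⟩ := isLeast_sdpObjective_of_coeff U E hc
    exact (hmin' hy : sdpObjective z ≤ sdpObjective y).trans hy'.le
  refine ⟨sdpObjective z, ⟨⟨z.1, hc, hval⟩, ?_⟩, ⟨z, hz, rfl⟩, ?_⟩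
  · rintro _ ⟨c, hc, rfl⟩
    exact hval.ge.trans (hcmin hc)
  · rintro _ ⟨y, hy, rfl⟩
    exact hmin' hy

end StrongDuality

/-! ### Semidefinite representability -/

/-- A set described by one linear matrix inequality, without auxiliary variables. -/
def IsSpectrahedron {V : Type*} [AddCommGroup V] [Module ℝ V] (S : Set V) : Prop :=
  ∃ (m : ℕ) (C : Matrix (Fin m) (Fin m) ℂ) (L : V →ₗ[ℝ] Matrix (Fin m) (Fin m) ℂ),
    ∀ x : V, x ∈ S ↔ (C + L x).PosSemidef

section Spectrahedron

variable {V W : Type*} [AddCommGroup V] [Module ℝ V] [AddCommGroup W] [Module ℝ W]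

theorem isSpectrahedron_lmi {n : Type*} [Fintype n] (C : Matrix n n ℂ)
    (L : V →ₗ[ℝ] Matrix n n ℂ) : IsSpectrahedron {x | (C + L x).PosSemidef} := by
  set e := Fintype.equivFin n
  refine ⟨Fintype.card n, C.submatrix e.symm e.symm,
    (reindexLinearEquiv ℝ ℂ e e).toLinearMap ∘ₗ L, fun x => ?_⟩
  exact (posSemidef_submatrix_equiv (M := C + L x) e.symm).symm

theorem isSpectrahedron_nonneg {κ : Type*} [Fintype κ] (c : κ → ℝ) (f : V →ₗ[ℝ] κ → ℝ) :
    IsSpectrahedron {x | ∀ k, 0 ≤ c k + f x k} := by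
  classical
  have h := isSpectrahedron_lmi (diagonal fun k => (c k : ℂ))
    (diagonalLinearMap κ ℝ ℂ ∘ₗ (Complex.ofRealAm.toLinearMap.compLeft κ) ∘ₗ f)
  convert h using 3 with x
  rw [show diagonal (fun k => (c k : ℂ)) +
      (diagonalLinearMap κ ℝ ℂ ∘ₗ (Complex.ofRealAm.toLinearMap.compLeft κ) ∘ₗ f) x =
      diagonal fun k => ((c k + f x k : ℝ) : ℂ) by
    ext i j
    by_cases hij : i = j
    · subst hij
      simp
    · simp [hij], posSemidef_diagonal_iff]
  simp only [Complex.zero_le_real]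

theorem posSemidef_fromBlocks_zero_iff {m n : Type*} [Fintype m] [Fintype n]
    {P : Matrix m m ℂ} {Q : Matrix n n ℂ} :
    (fromBlocks P 0 0 Q).PosSemidef ↔ P.PosSemidef ∧ Q.PosSemidef := by
  classical
  refine ⟨fun h => ⟨h.submatrix Sum.inl, h.submatrix Sum.inr⟩, fun ⟨hP, hQ⟩ => ?_⟩
  obtain ⟨B, rfl⟩ := exists_eq_conjTranspose_mul_self hP
  obtain ⟨D, rfl⟩ := exists_eq_conjTranspose_mul_self hQ
  have h := posSemidef_conjTranspose_mul_self (fromBlocks B 0 0 D)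
  simpa [fromBlocks_conjTranspose, fromBlocks_multiply] using h

theorem IsSpectrahedron.inter {S T : Set V} (hS : IsSpectrahedron S) (hT : IsSpectrahedron T) :
    IsSpectrahedron (S ∩ T) := by
  obtain ⟨m, C, L, hL⟩ := hS
  obtain ⟨n, D, K, hK⟩ := hT
  -- Two matrix inequalities hold together exactly when their block-diagonal sum is positive
  -- semidefinite.
  have h := isSpectrahedron_lmi (fromBlocks C 0 0 D)
    ({ toFun := fun x => fromBlocks (L x) 0 0 (K x)
       map_add' := fun x y => by simp [fromBlocks_add]
       map_smul' := fun t x => by simp [fromBlocks_smul] } :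
      V →ₗ[ℝ] Matrix (Fin m ⊕ Fin n) (Fin m ⊕ Fin n) ℂ)
  convert h using 1
  ext x
  simp [fromBlocks_add, posSemidef_fromBlocks_zero_iff, hL, hK]

theorem IsSpectrahedron.semidefiniteRepresentable [FiniteDimensional ℝ W] {S : Set (V × W)}
    (hS : IsSpectrahedron S) : SemidefiniteRepresentable {x : V | ∃ w : W, (x, w) ∈ S} := by
  obtain ⟨m, C, L, hL⟩ := hS
  have e : W ≃ₗ[ℝ] (Fin (Module.finrank ℝ W) → ℝ) := (Module.finBasis ℝ W).equivFun
  refine ⟨Module.finrank ℝ W, m, C,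
    L ∘ₗ (LinearMap.prodMap LinearMap.id e.symm.toLinearMap), fun x => ?_⟩
  simp only [Set.mem_ofPred_eq, hL]
  constructor
  · rintro ⟨w, hw⟩
    exact ⟨e w, by simpa using hw⟩
  · rintro ⟨u, hu⟩
    exact ⟨e.symm u, by simpa using hu⟩

end Spectrahedron

section Representability

variable {a b ι : Type*} [Fintype a] [DecidableEq a] [Fintype b] [DecidableEq b] [Fintype ι]

/-- The variables of the semidefinite program, the epigraph variable, and auxiliary bounds on
`|a_i|` and on the two spectral norms. -/
abbrev SDPLiftVar (a b ι : Type*) : Type _ := (SDPVar a b ι × ℝ) × ((ι → ℝ) × ℝ × ℝ)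

/-- The linear part of the block constraint. -/
def sdpBlockLinearMap (E : ι → Matrix a a ℂ →ₗ[ℂ] Matrix b b ℂ) :
    SDPLiftVar a b ι →ₗ[ℝ] Matrix ((b × a) ⊕ (b × a)) ((b × a) ⊕ (b × a)) ℂ where
  toFun y := fromBlocks y.1.1.2.1 (∑ i, (y.1.1.1 i : ℂ) • choi (E i))
    (∑ i, (y.1.1.1 i : ℂ) • (choi (E i))ᴴ) y.1.1.2.2
  map_add' x y := by simp [fromBlocks_add, add_smul, Finset.sum_add_distrib]
  map_smul' t x := by
    simp only [Prod.smul_fst, Prod.smul_snd, Pi.smul_apply, smul_eq_mul, Complex.ofReal_mul,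
      RingHom.id_apply, fromBlocks_smul, Finset.smul_sum, mul_smul, Complex.coe_smul]

omit [DecidableEq b] in
theorem isSpectrahedron_sdpBlock (U : Matrix a a ℂ →ₗ[ℂ] Matrix b b ℂ)
    (E : ι → Matrix a a ℂ →ₗ[ℂ] Matrix b b ℂ) :
    IsSpectrahedron {y : SDPLiftVar a b ι | (Matrix.fromBlocks y.1.1.2.1
      (∑ i, (y.1.1.1 i : ℂ) • choi (E i) - choi U)
      (∑ i, (y.1.1.1 i : ℂ) • (choi (E i)).conjTranspose - (choi U).conjTranspose)
      y.1.1.2.2).PosSemidef} := by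
  have h := isSpectrahedron_lmi (fromBlocks 0 (-choi U) (-(choi U)ᴴ) 0) (sdpBlockLinearMap E)
  convert h using 3 with y
  simp [sdpBlockLinearMap, fromBlocks_add, sub_eq_neg_add]

/-- The partial trace as a real linear map. -/
def partialTraceBLinearMap (a b : Type*) [Fintype b] :
    Matrix (b × a) (b × a) ℂ →ₗ[ℝ] Matrix a a ℂ where
  toFun := partialTraceB
  map_add' := partialTraceB_add
  map_smul' := partialTraceB_smul

omit [DecidableEq b] in
theorem isSpectrahedron_partialTraceB_le {V : Type*} [AddCommGroup V] [Module ℝ V]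
    (Y : V →ₗ[ℝ] Matrix (b × a) (b × a) ℂ) (s : V →ₗ[ℝ] ℝ) :
    IsSpectrahedron {y : V |
      ((s y : ℂ) • (1 : Matrix a a ℂ) - partialTraceB (Y y)).PosSemidef} := by
  have h := isSpectrahedron_lmi 0
    (s.smulRight (1 : Matrix a a ℂ) - partialTraceBLinearMap a b ∘ₗ Y)
  convert h using 3 with y
  simp [partialTraceBLinearMap]

theorem isSpectrahedron_posSemidef {V : Type*} [AddCommGroup V] [Module ℝ V] {n : Type*}
    [Fintype n] (Y : V →ₗ[ℝ] Matrix n n ℂ) : IsSpectrahedron {y : V | (Y y).PosSemidef} := by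
  simpa using isSpectrahedron_lmi 0 Y

theorem isSpectrahedron_nonneg_apply {V : Type*} [AddCommGroup V] [Module ℝ V] (c : ℝ)
    (f : V →ₗ[ℝ] ℝ) : IsSpectrahedron {y : V | 0 ≤ c + f y} := by
  simpa using isSpectrahedron_nonneg (fun _ : Unit => c) (LinearMap.pi fun _ => f)

omit [DecidableEq b] in
theorem isSemidefiniteProgram_sdp (U : Matrix a a ℂ →ₗ[ℂ] Matrix b b ℂ)
    (E : ι → Matrix a a ℂ →ₗ[ℂ] Matrix b b ℂ) (γ : ℝ) :
    IsSemidefiniteProgram (sdpFeasible U E γ) (sdpObjective (a := a) (b := b) (ι := ι)) := by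
  let pz : SDPLiftVar a b ι →ₗ[ℝ] SDPVar a b ι := LinearMap.fst ℝ _ _ ∘ₗ LinearMap.fst ℝ _ _
  let pt : SDPLiftVar a b ι →ₗ[ℝ] ℝ := LinearMap.snd ℝ _ _ ∘ₗ LinearMap.fst ℝ _ _
  let pc : SDPLiftVar a b ι →ₗ[ℝ] ι → ℝ := LinearMap.fst ℝ _ _ ∘ₗ pz
  let pY₀ : SDPLiftVar a b ι →ₗ[ℝ] Matrix (b × a) (b × a) ℂ :=
    LinearMap.fst ℝ _ _ ∘ₗ LinearMap.snd ℝ _ _ ∘ₗ pz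
  let pY₁ : SDPLiftVar a b ι →ₗ[ℝ] Matrix (b × a) (b × a) ℂ :=
    LinearMap.snd ℝ _ _ ∘ₗ LinearMap.snd ℝ _ _ ∘ₗ pz
  let pu : SDPLiftVar a b ι →ₗ[ℝ] ι → ℝ := LinearMap.fst ℝ _ _ ∘ₗ LinearMap.snd ℝ _ _
  let ps₀ : SDPLiftVar a b ι →ₗ[ℝ] ℝ :=
    LinearMap.fst ℝ _ _ ∘ₗ LinearMap.snd ℝ _ _ ∘ₗ LinearMap.snd ℝ _ _
  let ps₁ : SDPLiftVar a b ι →ₗ[ℝ] ℝ :=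
    LinearMap.snd ℝ _ _ ∘ₗ LinearMap.snd ℝ _ _ ∘ₗ LinearMap.snd ℝ _ _
  have h := ((isSpectrahedron_sdpBlock U E).inter <|
    (isSpectrahedron_posSemidef pY₀).inter <|
    (isSpectrahedron_posSemidef pY₁).inter <|
    (isSpectrahedron_partialTraceB_le pY₀ ps₀).inter <|
    (isSpectrahedron_partialTraceB_le pY₁ ps₁).inter <|
    (isSpectrahedron_nonneg 0 (pu - pc)).inter <|
    (isSpectrahedron_nonneg 0 (pu + pc)).inter <|
    (isSpectrahedron_nonneg_apply γ (-∑ i, LinearMap.proj i ∘ₗ pu)).inter <|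
    -- Nonnegativity of the norm bounds must be imposed separately: when `a` is empty, `s • 1 - N ≥
    -- 0` holds for negative `s` too.
    (isSpectrahedron_nonneg_apply 0 ps₀).inter <|
    (isSpectrahedron_nonneg_apply 0 ps₁).inter <|
    isSpectrahedron_nonneg_apply 0
      (pt - ((1 / 2 : ℝ) • ps₀ + (1 / 2 : ℝ) • ps₁))).semidefiniteRepresentable
  unfold IsSemidefiniteProgram
  convert h using 1
  ext ⟨⟨c, Y₀, Y₁⟩, t⟩
  simp only [pz, pt, pc, pY₀, pY₁, pu, ps₀, ps₁, Set.mem_ofPred_eq, Set.mem_inter_iff,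
    LinearMap.coe_comp, Function.comp_apply, LinearMap.fst_apply, LinearMap.snd_apply,
    LinearMap.sub_apply, LinearMap.add_apply, LinearMap.neg_apply, LinearMap.smul_apply,
    LinearMap.sum_apply, LinearMap.proj_apply, Pi.zero_apply, Pi.sub_apply, Pi.add_apply,
    zero_add, smul_eq_mul, sdpFeasible, sdpObjective]
  constructor
  · rintro ⟨⟨hb, hγ, h₀, h₁⟩, ht⟩
    refine ⟨(fun i => |c i|, specNorm (partialTraceB Y₀), specNorm (partialTraceB Y₁)), hb, h₀, h₁,
      (specNorm_le_iff (posSemidef_partialTraceB h₀) (specNorm_nonneg _)).1 le_rfl,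
      (specNorm_le_iff (posSemidef_partialTraceB h₁) (specNorm_nonneg _)).1 le_rfl,
      fun k => sub_nonneg.2 (le_abs_self _), fun k => ?_, ?_, specNorm_nonneg _,
      specNorm_nonneg _, sub_nonneg.2 ht⟩
    · exact neg_le_iff_add_nonneg.1 (neg_le_abs _)
    · exact le_add_neg_iff_add_le.2 (by simpa [gammaFactor] using hγ)
  · rintro ⟨⟨u, s₀, s₁⟩, hb, h₀, h₁, hs₀, hs₁, hu, hu', hγ, n₀, n₁, ht⟩
    have e₀ := (specNorm_le_iff (posSemidef_partialTraceB h₀) n₀).2 hs₀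
    have e₁ := (specNorm_le_iff (posSemidef_partialTraceB h₁) n₁).2 hs₁
    refine ⟨⟨hb, ?_, h₀, h₁⟩, ?_⟩
    · have h2 : ∑ i, |c i| ≤ ∑ i, u i := Finset.sum_le_sum fun i _ =>
        abs_le.2 ⟨by linarith [hu' i], by linarith [hu i]⟩
      exact h2.trans (by linarith)
    · simp only at ht e₀ e₁ ⊢
      linarith

end Representability

end

end ApproxQPD

theorem mainTheorem1 {a b ι : Type*} [Fintype a] [DecidableEq a] [Fintype b] [DecidableEq b]
    [Fintype ι] (U : Matrix a a ℂ →ₗ[ℂ] Matrix b b ℂ)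
    (E : ι → Matrix a a ℂ →ₗ[ℂ] Matrix b b ℂ) (γ : ℝ) :
    -- the program with variables `(a, Y₀, Y₁)` is a semidefinite program
    ApproxQPD.IsSemidefiniteProgram (ApproxQPD.sdpFeasible U E γ)
      (ApproxQPD.sdpObjective (a := a) (b := b) (ι := ι)) ∧
    -- for a nonnegative budget, both minima are attained and they are equal
    (0 ≤ γ → ∃ v : ℝ,
      IsLeast (ApproxQPD.budgetObjective U E '' ApproxQPD.budgetFeasible ι γ) v ∧
      IsLeast (ApproxQPD.sdpObjective '' ApproxQPD.sdpFeasible U E γ) v) ∧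
    -- for fixed coefficients within the budget, minimising over `Y₀, Y₁` gives the diamond norm
    (∀ c ∈ ApproxQPD.budgetFeasible ι γ,
      IsLeast (ApproxQPD.sdpObjective '' {z ∈ ApproxQPD.sdpFeasible U E γ | z.1 = c})
        (ApproxQPD.budgetObjective U E c)) ∧
    -- the optimal coefficients of the two problems are the same
    (∀ c : ι → ℝ,
      (c ∈ ApproxQPD.budgetFeasible ι γ ∧
        IsMinOn (ApproxQPD.budgetObjective U E) (ApproxQPD.budgetFeasible ι γ) c) ↔
      ∃ z ∈ ApproxQPD.sdpFeasible U E γ,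
        IsMinOn ApproxQPD.sdpObjective (ApproxQPD.sdpFeasible U E γ) z ∧ z.1 = c) :=
  ⟨ApproxQPD.isSemidefiniteProgram_sdp U E γ,
    fun hγ => ApproxQPD.exists_isLeast_budgetObjective_and_sdpObjective U E hγ,
    fun _ hc => ApproxQPD.isLeast_sdpObjective_of_coeff U E hc,
    fun c => ApproxQPD.isMinOn_budgetObjective_iff U E γ c⟩
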